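/- Let $G$ be a countably infinite discrete group. Let $G$ act on $2^G=\{0,1\}^G$ (with the product Borel structure) by the left shift $(g\cdot w)(h)=w(g^{-1}h)$, let $$\mathrm{Free}(2^G)=\{w\in 2^G : g\cdot w\neq w \text{ for all } g\in G\setminus\{1_G\}\},$$ and let $F(G,2)$ be the orbit equivalence relation of $G$ on $\mathrm{Free}(2^G)$. Let $L=(R_i)_{i\in I}$ be a countable relational language, where $R_i$ has arity $n_i$, and let $\mathcal K$ be a class of countable $L$-structures that is closed under isomorphism. A countable Borel equivalence relation $E$ on a standard Borel space $X$ is called *Borel $\mathcal K$-structurable* if there are Borel sets $Q_i\subseteq X^{n_i}$ $(i\in I)$, each consisting of tuples of pairwise $E$-equivalent points, such that for every $x\in X$ the $L$-structure $\langle [x]_E,(Q_i\cap [x]_E^{\,n_i})_{i\in I}\rangle$ belongs to $\mathcal K$. If $F(G,2)$ is Borel $\mathcal K$-structurable, then for every free Borel action of $G$ on a standard Borel space $X$, the orbit equivalence relation of $G$ on $X$ is Borel $\mathcal K$-structurable. -/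

import Mathlib

open CategoryTheory

universe u v w

namespace BorelStructurability

/-! ### The shift and its free part -/

/-- The `A`-shift `A^G` of a group `G`, that is, the set of all functions `G → A`. -/
def Shift (G : Type u) (A : Type v) : Type (max u v) := G → A

/-- The product σ-algebra. For countable `G` and `A` standard Borel it is the Borel σ-algebra of the
product topology. -/
instance instMeasurableSpaceShift (G : Type u) (A : Type v) [MeasurableSpace A] : MeasurableSpace (Shift G A) :=
  inferInstanceAs (MeasurableSpace (G → A))

/-- The left shift action `(g • w)(h) = w(g⁻¹ h)`. -/
instance instMulActionShift (G : Type u) [Group G] (A : Type v) : MulAction G (Shift G A) where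
  smul g w := fun h => w (g⁻¹ * h)
  one_smul w := funext fun h => congrArg w (by rw [inv_one, one_mul])
  mul_smul a b w := funext fun h => congrArg w (by rw [mul_inv_rev, mul_assoc])

/-- The free part of `A^G`: the set of points with trivial stabilizer. -/
def freePart (G : Type u) [Group G] (A : Type v) : Set (Shift G A) :=
  {w | ∀ g : G, g ≠ 1 → g • w ≠ w}

/-- The shift action restricts to the free part. -/
instance instMulActionFreePart (G : Type u) [Group G] (A : Type v) : MulAction G (freePart G A) where
  smul g w := ⟨g • w.1, fun k hk h => w.2 (g⁻¹ * k * g)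
    (fun h1 => hk (by
      have h2 : g * (g⁻¹ * k * g) * g⁻¹ = k := by group
      rw [← h2, h1, mul_one, mul_inv_cancel]))
    (by rw [mul_smul, mul_smul, h, inv_smul_smul])⟩
  one_smul w := Subtype.ext (one_smul G w.1)
  mul_smul a b w := Subtype.ext (mul_smul a b w.1)

/-- The equivalence relation `F(G, A)` generated by the action of `G` on the free part of `A^G`. -/
def freeShiftRel (G : Type u) [Group G] (A : Type v) : Setoid (freePart G A) :=
  MulAction.orbitRel G (freePart G A)

/-! ### Borel structurability -/

/-- A set `X` with relations `Q R ⊆ X ^ n`, one for each `n`-ary symbol `R` of a relational language,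
induces by restriction a structure on each subset `C` of `X`. -/
@[reducible]
def restrictStructure {L : FirstOrder.Language.{v, w}} [L.IsRelational] {X : Type u}
    (Q : ∀ n : ℕ, L.Relations n → Set (Fin n → X)) (C : Set X) : L.Structure C where
  funMap f := isEmptyElim f
  RelMap {n} R := fun a => (fun i => (a i : X)) ∈ Q n R

/-- `Q` is a Borel `K`-structuring of the equivalence relation `E`: each `Q n R` is a Borel set of
`n`-tuples of pairwise `E`-equivalent points, and each `E`-class, with the restrictions of the
`Q n R` to it, is a member of `K`. -/
structure IsBorelStructuring {L : FirstOrder.Language.{v, w}} [L.IsRelational]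
    (K : Set (Bundled.{u} L.Structure)) {X : Type u} [MeasurableSpace X] (E : Setoid X)
    (Q : ∀ n : ℕ, L.Relations n → Set (Fin n → X)) : Prop where
  measurableSet : ∀ (n : ℕ) (R : L.Relations n), MeasurableSet (Q n R)
  related : ∀ (n : ℕ) (R : L.Relations n), ∀ a ∈ Q n R, ∀ i j : Fin n, E.r (a i) (a j)
  mem_class : ∀ x : X,
    (⟨{y : X | E.r y x}, restrictStructure Q {y : X | E.r y x}⟩ : Bundled.{u} L.Structure) ∈ K

/-- `E` is Borel `K`-structurable if it admits a Borel `K`-structuring. -/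
def IsBorelStructurable {L : FirstOrder.Language.{v, w}} [L.IsRelational]
    (K : Set (Bundled.{u} L.Structure)) {X : Type u} [MeasurableSpace X] (E : Setoid X) : Prop :=
  ∃ Q : ∀ n : ℕ, L.Relations n → Set (Fin n → X), IsBorelStructuring K E Q

end BorelStructurability

/-! Structurability pulls back along an equivariant Borel map `φ : X → Free(2^G)`: the shift acts
freely there, so `φ` is a bijection from each orbit onto an orbit, and the relations can be pulled
back within orbits (`IsBorelStructurable.comap`). It remains to find `φ` for every free Borel
action, i.e. a Borel set `A` such that for `g ≠ 1` and every `x` some `h` puts exactly one of `h •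
x`, `(h * g) • x` in `A`.

The set is built by extending partial 2-colourings, one `g` at a time, while the uncoloured set
stays syndetic (`exists_separating_extension`). One step fixes a large finite window `W` and a
maximal Borel set `Y` of centres with well-separated windows. A few uncoloured points near each
centre are reserved; the other uncoloured points of the windows are to be coloured so that the
windows at `z` and `k • z` differ, for `z` in `Y` and `k` a conjugate of `g`.

Cells choose their patterns greedily along a countable Borel colouring. A constraint compares the
ends of at least `6 * r` edges; at least `3 * r` of them are settled by one cell, the later one of
at most two. Among these, `r` are disjoint, so violating the constraint has probability at most `2 ^
(-r)`. Only polynomially many constraints in `r` meet a cell, so for large `r` a union bound leaves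
a good pattern (`exists_pattern`, `exists_cell_coloring`). -/

open scoped Pointwise

namespace BorelStructurability

/-! ### Measurable maps to countable discrete sets -/

/-- A map to a set, thought of as discrete, all of whose fibres are measurable. -/
def MeasurableFibers {X Λ : Type*} [MeasurableSpace X] (f : X → Λ) : Prop :=
  ∀ v, Measurable fun x => f x = v

/-- The substitution rule for discrete values: `f x` ranges over a countable set, so the predicate
is a countable union over the possible values. -/
theorem MeasurableFibers.pred {X Λ : Type*} [MeasurableSpace X] [Countable Λ] {f : X → Λ}
    (hf : MeasurableFibers f) {q : X → Λ → Prop} (hq : ∀ v, Measurable fun x => q x v) :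
    Measurable fun x => q x (f x) := by
  have : (fun x => q x (f x)) = fun x => ∃ v, f x = v ∧ q x v := by
    funext x; simp
  rw [this]
  exact Measurable.exists fun v => (hf v).and (hq v)

theorem MeasurableFibers.comp {X Y Λ : Type*} [MeasurableSpace X] [MeasurableSpace Y] {f : X → Λ}
    (hf : MeasurableFibers f) {φ : Y → X} (hφ : Measurable φ) :
    MeasurableFibers fun y => f (φ y) :=
  fun v => (hf v).comp hφ

theorem MeasurableFibers.map {X Λ Λ' : Type*} [MeasurableSpace X] [Countable Λ] {f : X → Λ}
    (hf : MeasurableFibers f) (φ : Λ → Λ') : MeasurableFibers fun x => φ (f x) :=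
  fun v => hf.pred (q := fun _ a => φ a = v) fun _ => measurable_const

theorem measurableFibers_ite {X Λ : Type*} [MeasurableSpace X] {p : X → Prop} [DecidablePred p]
    {f g : X → Λ} (hp : Measurable p) (hf : MeasurableFibers f) (hg : MeasurableFibers g) :
    MeasurableFibers fun x => if p x then f x else g x := by
  intro v
  have : (fun x => (if p x then f x else g x) = v) =
      fun x => (p x ∧ f x = v) ∨ (¬ p x ∧ g x = v) := by
    funext x; by_cases h : p x <;> simp [h]
  rw [this]
  exact (hp.and (hf v)).or (hp.not.and (hg v))

theorem measurableFibers_const {X Λ : Type*} [MeasurableSpace X] (a : Λ) :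
    MeasurableFibers fun _ : X => a :=
  fun _ => measurable_const

theorem measurableFibers_decide {X : Type*} [MeasurableSpace X] {p : X → Prop} [DecidablePred p]
    (hp : Measurable p) : MeasurableFibers fun x => decide (p x) := by
  have := measurableFibers_ite hp (measurableFibers_const true) (measurableFibers_const false)
  convert this using 2 with x
  by_cases h : p x <;> simp [h]

theorem measurableFibers_filter {X ι : Type*} [MeasurableSpace X] [Countable ι] (S : Finset ι)
    {p : X → ι → Prop} [∀ x, DecidablePred (p x)] (hp : ∀ i, Measurable fun x => p x i) :
    MeasurableFibers fun x => S.filter (p x) := by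
  intro T
  have : (fun x => S.filter (p x) = T) = fun x => ∀ i, (i ∈ S ∧ p x i ↔ i ∈ T) := by
    funext x
    simp [Finset.ext_iff]
  rw [this]
  exact Measurable.forall fun i => (measurable_const.and (hp i)).iff measurable_const

/-! ### Borel colourings and greedy recursion -/

/-- Every finite part of a free Borel graph has a countable Borel colouring. -/
theorem exists_nat_coloring {G X : Type*} [Group G] [Countable G] [MeasurableSpace X]
    [StandardBorelSpace X] [MulAction G X] [MeasurableConstSMul G X]
    (hfree : ∀ (g : G) (x : X), g • x = x → g = 1) (T : Finset G) :
    ∃ c : X → ℕ, MeasurableFibers c ∧ ∀ x, ∀ t ∈ T, t ≠ 1 → c (t • x) ≠ c x := by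
  classical
  obtain ⟨φ, hφm, hφi⟩ := MeasurableSpace.measurable_injection_nat_bool_of_countablySeparated X
  -- `B (n, s)` is the cylinder of points whose first `n` digits are given by `s`. The colour of `x`
  -- is the first cylinder that contains `x` and none of its neighbours, so neighbours cannot share
  -- a colour.
  let B : ℕ × Finset ℕ → X → Prop := fun q x => ∀ j < q.1, φ x j = decide (j ∈ q.2)
  have hB : ∀ q, Measurable (B q) := fun q => by
    refine Measurable.forall fun j => measurable_const.imp ?_
    exact measurableSet_setOfPred.1
      (((measurable_pi_apply j).comp hφm) (measurableSet_singleton (decide (j ∈ q.2))))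
  obtain ⟨enum, henum⟩ := exists_surjective_nat (ℕ × Finset ℕ)
  let P : X → ℕ → Prop := fun x m => B (enum m) x ∧ ∀ t ∈ T, t ≠ 1 → ¬ B (enum m) (t • x)
  have hP : ∀ x, ∃ m, P x m := by
    intro x
    have h1 : ∀ t : G, ∃ j, t ≠ 1 → φ x j ≠ φ (t • x) j := by
      intro t
      by_cases ht : t = 1
      · exact ⟨0, fun h => (h ht).elim⟩
      · by_contra! hcon
        exact ht (hfree t x (hφi (funext fun j => ((hcon j).2).symm)))
    choose j hj using h1
    obtain ⟨m, hm⟩ := henum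
      (T.sup j + 1, (Finset.range (T.sup j + 1)).filter fun i => φ x i = true)
    refine ⟨m, ?_, ?_⟩
    · intro i hi
      rw [hm] at hi ⊢
      simp only [Finset.mem_filter, Finset.mem_range]
      by_cases h : φ x i = true <;> simp_all
    · intro t ht ht1 hcon
      have hlt : j t < T.sup j + 1 := Nat.lt_succ_of_le (Finset.le_sup ht)
      have := hcon (j t) (by rw [hm]; exact hlt)
      rw [hm] at this
      simp only [Finset.mem_filter, Finset.mem_range, hlt, true_and] at this
      apply hj t ht1
      rw [this]
      by_cases h : φ x (j t) = true <;> simp_all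
  have hPm : ∀ m, Measurable fun x => P x m := fun m =>
    (hB _).and (Measurable.forall fun t => measurable_const.imp (measurable_const.imp
      ((hB _).comp (measurable_const_smul t)).not))
  refine ⟨fun x => Nat.find (hP x), ?_, ?_⟩
  · intro n
    have : Measurable fun x => Nat.find (hP x) :=
      measurable_find hP fun k => measurableSet_setOfPred.2 (hPm k)
    exact measurableSet_setOfPred.1 (this (measurableSet_singleton n))
  · intro x t ht ht1 heq
    have h1 := Nat.find_spec (hP x)
    have h2 := Nat.find_spec (hP (t • x))
    apply h1.2 t ht ht1
    dsimp only at heq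
    rw [heq] at h2
    exact h2.1

open Classical in
/-- A map may be defined by Borel recursion along a countable Borel colouring. -/
theorem exists_greedy {X Λ : Type*} [MeasurableSpace X] {c : X → ℕ} (hc : MeasurableFibers c)
    (Φ : X → (X → Option Λ) → Λ)
    (hΦ : ∀ p, MeasurableFibers p → MeasurableFibers fun x => Φ x p) :
    ∃ f : X → Λ, MeasurableFibers f ∧
      ∀ x, f x = Φ x fun y => if c y < c x then some (f y) else none := by
  -- `F n` is the part of the map known once all colours below `n` are treated.
  let F : ℕ → X → Option Λ := fun n => Nat.rec (fun _ => none)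
    (fun n Fn x => if c x = n then some (Φ x Fn) else Fn x) n
  have hF0 : F 0 = fun _ => none := rfl
  have hF : ∀ n, F (n + 1) = fun x => if c x = n then some (Φ x (F n)) else F n x := fun _ => rfl
  let f : X → Λ := fun x => Φ x (F (c x))
  have hFf : ∀ n, F n = fun y => if c y < n then some (f y) else none := by
    intro n
    induction n with
    | zero => simp [hF0]
    | succ n ih =>
      rw [hF]
      funext y
      rcases lt_trichotomy (c y) n with h | h | h
      · simp [h.ne, ih, h, Nat.lt_succ_of_lt h]
      · subst h; simp [f]
      · simp [h.ne', ih, h.not_gt, Nat.not_lt.2 (Nat.succ_le_of_lt h)]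
  have hFm : ∀ n, MeasurableFibers (F n) := by
    intro n
    induction n with
    | zero => rw [hF0]; exact measurableFibers_const _
    | succ n ih =>
      rw [hF]
      refine measurableFibers_ite (hc n) ?_ ih
      rintro (_ | v)
      · simp
      · simpa using hΦ _ ih v
  refine ⟨f, ?_, fun x => ?_⟩
  · intro v
    exact hc.pred (q := fun x n => Φ x (F n) = v) fun n => hΦ _ (hFm n) v
  · conv_lhs => rw [show f x = Φ x (F (c x)) from rfl, hFf]

/-- Maximal separated sets. -/
theorem exists_maximal_separated {G X : Type*} [Group G] [Countable G] [MeasurableSpace X]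
    [StandardBorelSpace X] [MulAction G X] [MeasurableConstSMul G X]
    (hfree : ∀ (g : G) (x : X), g • x = x → g = 1) (V : Finset G) (h1 : (1 : G) ∈ V)
    (hinv : ∀ t ∈ V, t⁻¹ ∈ V) :
    ∃ Y : X → Prop, Measurable Y ∧ (∀ x, Y x → ∀ t ∈ V, t ≠ 1 → ¬ Y (t • x)) ∧
      ∀ x, ∃ t ∈ V, Y (t • x) := by
  classical
  obtain ⟨c, hc, hcV⟩ := exists_nat_coloring hfree V
  -- A point joins the set unless a `V`-neighbour of smaller colour has already joined.
  obtain ⟨f, hf, hfx⟩ := exists_greedy hc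
    (fun x p => decide (∀ t ∈ V, p (t • x) ≠ some true)) (fun p hp =>
      measurableFibers_decide (Measurable.forall fun t => measurable_const.imp
        ((hp.comp (measurable_const_smul t)) (some true)).not))
  have key : ∀ x, f x = true ↔ ∀ t ∈ V, c (t • x) < c x → f (t • x) = false := by
    intro x
    rw [hfx x]
    simp only [decide_eq_true_eq]
    refine forall₂_congr fun t _ => ?_
    by_cases h : c (t • x) < c x <;> simp [h]
  refine ⟨fun x => f x = true, hf true, fun x hx t ht ht1 htx => ?_, fun x => ?_⟩
  · rcases lt_trichotomy (c (t • x)) (c x) with h | h | h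
    · simp [(key x).1 hx t ht h] at htx
    · exact hcV x t ht ht1 h
    · have := (key _).1 htx t⁻¹ (hinv t ht)
      rw [inv_smul_smul] at this
      simp [this h] at hx
  · by_contra! hcon
    have h := hcon 1 h1
    rw [one_smul] at h
    refine h ((key x).2 fun t ht _ => ?_)
    simpa using hcon t ht

/-! ### Patterns avoiding few constraints -/

/-- A family of `N` edges given by two injections contains at least `N / 3` disjoint ones. -/
theorem exists_disjoint_edges {ι α : Type*} [DecidableEq ι] (J : Finset ι) (a b : ι → α)
    (ha : Set.InjOn a J) (hb : Set.InjOn b J) :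
    ∃ M ⊆ J, J.card ≤ 3 * M.card ∧
      ∀ i ∈ M, ∀ j ∈ M, i ≠ j → a i ≠ b j := by
  classical
  -- By maximality each remaining edge meets a member of `M`; by injectivity of `a` and `b` each
  -- member excludes at most two edges.
  obtain ⟨M, hM, hmax⟩ := (J.powerset.filter fun M =>
    ∀ i ∈ M, ∀ j ∈ M, i ≠ j → a i ≠ b j).exists_maximal ⟨∅, by simp⟩
  simp only [Finset.mem_filter, Finset.mem_powerset] at hM hmax
  refine ⟨M, hM.1, ?_, hM.2⟩
  have hsub : J ⊆ (M ∪ J.filter fun i => ∃ j ∈ M, a i = b j) ∪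
      J.filter fun i => ∃ j ∈ M, a j = b i := by
    intro i hi
    by_contra hcon
    simp only [Finset.mem_union, Finset.mem_filter, not_or, not_and, not_exists] at hcon
    obtain ⟨⟨hiM, h1⟩, h2⟩ := hcon
    have := @hmax (insert i M) ⟨Finset.insert_subset hi hM.1, ?_⟩ (Finset.subset_insert _ _)
    · exact hiM (this (Finset.mem_insert_self _ _))
    · intro j hj k hk hjk
      rw [Finset.mem_insert] at hj hk
      rcases hj with rfl | hj <;> rcases hk with rfl | hk
      · exact (hjk rfl).elim
      · exact h1 hi k hk
      · exact h2 hi j hj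
      · exact hM.2 j hj k hk hjk
  have hc1 : (J.filter fun i => ∃ j ∈ M, a i = b j).card ≤ M.card := by
    calc _ = ((J.filter fun i => ∃ j ∈ M, a i = b j).image a).card :=
          (Finset.card_image_of_injOn (ha.mono fun x hx => (Finset.mem_filter.1 hx).1)).symm
      _ ≤ (M.image b).card := Finset.card_le_card (by
          intro y hy; simp only [Finset.mem_image, Finset.mem_filter] at hy ⊢
          obtain ⟨i, ⟨_, j, hj, h⟩, rfl⟩ := hy; exact ⟨j, hj, h.symm⟩)
      _ ≤ _ := Finset.card_image_le
  have hc2 : (J.filter fun i => ∃ j ∈ M, a j = b i).card ≤ M.card := by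
    calc _ = ((J.filter fun i => ∃ j ∈ M, a j = b i).image b).card :=
          (Finset.card_image_of_injOn (hb.mono fun x hx => (Finset.mem_filter.1 hx).1)).symm
      _ ≤ (M.image a).card := Finset.card_le_card (by
          intro y hy; simp only [Finset.mem_image, Finset.mem_filter] at hy ⊢
          obtain ⟨i, ⟨_, j, hj, h⟩, rfl⟩ := hy; exact ⟨j, hj, h⟩)
      _ ≤ _ := Finset.card_image_le
  calc J.card ≤ _ := Finset.card_le_card hsub
    _ ≤ _ := Finset.card_union_le _ _
    _ ≤ (M.card + M.card) + M.card := add_le_add ((Finset.card_union_le _ _).trans (by gcongr)) hc2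
    _ = _ := by ring

open Classical in
/-- The patterns `s ⊆ W` that identify the two ends of each of the edges `J`, where points outside
`O` carry fixed colours, are few. -/
theorem card_patterns_le {ι α : Type*} (W : Finset α) (O : Set α) (κ : α → Bool) (J : Finset ι)
    (a b : ι → α) (ha : Set.InjOn a J) (hb : Set.InjOn b J) (hab : ∀ i ∈ J, a i ≠ b i)
    (hO : O ⊆ W) (haO : ∀ i ∈ J, a i ∈ O ∨ b i ∈ O) (r : ℕ) (hr : 3 * r ≤ J.card) :
    (W.powerset.filter fun s => ∀ i ∈ J,
      (if a i ∈ O then decide (a i ∈ s) else κ (a i)) =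
        if b i ∈ O then decide (b i ∈ s) else κ (b i)).card ≤ 2 ^ (W.card - r) ∧ r ≤ W.card := by
  obtain ⟨M, hMJ, hM3, hM⟩ := exists_disjoint_edges J a b ha hb
  have hrM : r ≤ M.card := by omega
  -- `m i` is an end in `O` and `m' i` the other end. Equality of colours forces the value at `m i`
  -- from that at `m' i`, which is never one of the `m j`; so a pattern is determined by its part
  -- off the `m i`.
  let m : ι → α := fun i => if a i ∈ O then a i else b i
  let m' : ι → α := fun i => if a i ∈ O then b i else a i
  have hmm : ∀ i ∈ M, ∀ j ∈ M, m i ≠ m' j := by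
    intro i hi j hj h
    by_cases hij : i = j
    · subst hij
      have := hab i (hMJ hi)
      by_cases h1 : a i ∈ O <;> simp only [m, m', h1, if_true, if_false] at h
      · exact this h
      · exact this h.symm
    · by_cases h1 : a i ∈ O <;> by_cases h2 : a j ∈ O <;>
        simp only [m, m', h1, h2, if_true, if_false] at h
      · exact hM i hi j hj hij h
      · exact hij (ha (hMJ hi) (hMJ hj) h)
      · exact hij (hb (hMJ hi) (hMJ hj) h)
      · exact hM j hj i hi (Ne.symm hij) h.symm
  have hminj : Set.InjOn m M := by
    intro i hi j hj h
    by_contra hij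
    by_cases h1 : a i ∈ O <;> by_cases h2 : a j ∈ O <;>
      simp only [m, h1, h2, if_true, if_false] at h
    · exact hij (ha (hMJ hi) (hMJ hj) h)
    · exact hM i hi j hj hij h
    · exact hM j hj i hi (Ne.symm hij) h.symm
    · exact hij (hb (hMJ hi) (hMJ hj) h)
  have hmO : ∀ i ∈ M, m i ∈ O := by
    intro i hi
    by_cases h1 : a i ∈ O
    · simp [m, h1]
    · simpa [m, h1] using haO i (hMJ hi)
  have hsubW : M.image m ⊆ W := by
    intro y hy
    obtain ⟨i, hi, rfl⟩ := Finset.mem_image.1 hy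
    exact hO (hmO i hi)
  have hcard : (W \ M.image m).card ≤ W.card - r := by
    rw [Finset.card_sdiff_of_subset hsubW, Finset.card_image_of_injOn hminj]
    omega
  refine ⟨?_, hrM.trans ((Finset.card_image_of_injOn hminj) ▸ Finset.card_le_card hsubW)⟩
  refine le_trans ?_ ((Finset.card_powerset (W \ M.image m)).le.trans
    (Nat.pow_le_pow_right two_pos hcard))
  refine Finset.card_le_card_of_injOn (fun s => s \ M.image m) ?_ ?_
  · intro s hs
    simp only [Finset.coe_filter, Finset.mem_powerset, Set.mem_ofPred_eq] at hs
    exact Finset.mem_coe.2 (Finset.mem_powerset.2 (Finset.sdiff_subset_sdiff hs.1 le_rfl))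
  · intro s hs s' hs' hss
    simp only [Finset.coe_filter, Finset.mem_powerset, Set.mem_ofPred_eq] at hs hs'
    have hout : ∀ u, u ∉ M.image m → (u ∈ s ↔ u ∈ s') := by
      intro u hu
      have := Finset.ext_iff.1 hss u
      simpa only [Finset.mem_sdiff, hu, not_false_eq_true, and_true] using this
    ext u
    by_cases hu : u ∈ M.image m
    · obtain ⟨i, hi, rfl⟩ := Finset.mem_image.1 hu
      have hm' : m' i ∉ M.image m := by
        intro h
        obtain ⟨j, hj, h⟩ := Finset.mem_image.1 h
        exact hmm j hj i hi h
      have h' := hout _ hm'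
      have e1 := hs.2 i (hMJ hi)
      have e2 := hs'.2 i (hMJ hi)
      have e3 := haO i (hMJ hi)
      by_cases h1 : a i ∈ O <;> by_cases h2 : b i ∈ O <;>
        simp only [m, m', h1, h2, if_true, if_false, or_self] at h' e1 e2 e3 ⊢ <;> grind
    · exact hout u hu

theorem MeasurableFibers.bind {X Λ Λ' : Type*} [MeasurableSpace X] [Countable Λ] {f : X → Λ}
    (hf : MeasurableFibers f) {F : Λ → X → Λ'} (hF : ∀ a, MeasurableFibers (F a)) :
    MeasurableFibers fun x => F (f x) x :=
  fun v => hf.pred (q := fun x a => F a x = v) fun a => hF a v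

open Classical in
/-- If there are fewer than `2 ^ r` constraints, each consisting of at least `3 * r` edges, then
some pattern on `W` separates the ends of an edge in each of them. -/
theorem exists_pattern {γ ι α : Type*} (W : Finset α) (O : Set α) (hO : O ⊆ W) (κ : α → Bool)
    (C : Finset γ) (J : γ → Finset ι) (a b : γ → ι → α) (ha : ∀ q, Set.InjOn (a q) (J q))
    (hb : ∀ q, Set.InjOn (b q) (J q)) (hab : ∀ q ∈ C, ∀ i ∈ J q, a q i ≠ b q i)
    (haO : ∀ q ∈ C, ∀ i ∈ J q, a q i ∈ O ∨ b q i ∈ O) (r : ℕ) (hC : C.card < 2 ^ r) :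
    ∃ s ⊆ W, ∀ q ∈ C, 3 * r ≤ (J q).card → ∃ i ∈ J q,
      (if a q i ∈ O then decide (a q i ∈ s) else κ (a q i)) ≠
        if b q i ∈ O then decide (b q i ∈ s) else κ (b q i) := by
  by_contra! hcon
  let bad : γ → Finset (Finset α) := fun q => W.powerset.filter fun s => ∀ i ∈ J q,
      (if a q i ∈ O then decide (a q i ∈ s) else κ (a q i)) =
        if b q i ∈ O then decide (b q i ∈ s) else κ (b q i)
  let C' := C.filter fun q => 3 * r ≤ (J q).card
  have hbad : ∀ q ∈ C', (bad q).card ≤ 2 ^ (W.card - r) ∧ r ≤ W.card := fun q hq => by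
    obtain ⟨hq, hr⟩ := Finset.mem_filter.1 hq
    exact card_patterns_le W O κ (J q) (a q) (b q) (ha q) (hb q) (hab q hq) hO (haO q hq) r hr
  have hcover : W.powerset ⊆ C'.biUnion bad := by
    intro s hs
    obtain ⟨q, hq, hr, h⟩ := hcon s (Finset.mem_powerset.1 hs)
    exact Finset.mem_biUnion.2
      ⟨q, Finset.mem_filter.2 ⟨hq, hr⟩, Finset.mem_filter.2 ⟨hs, h⟩⟩
  obtain ⟨q, hq, -⟩ := hcon ∅ (Finset.empty_subset _)
  obtain ⟨q₀, hq₀, -⟩ := Finset.mem_biUnion.1 (hcover (Finset.empty_mem_powerset W))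
  have hrW := (hbad q₀ hq₀).2
  -- Union bound: fewer than `2 ^ r` bad sets, each at most a `2 ^ (-r)` fraction of the patterns,
  -- cannot cover them all. `hrW` makes the truncated subtraction exact.
  have h1 : 2 ^ W.card ≤ C'.card * 2 ^ (W.card - r) := by
    rw [← Finset.card_powerset]
    exact (Finset.card_le_card hcover).trans
      (Finset.card_biUnion_le_card_mul _ _ _ fun q hq => (hbad q hq).1)
  have h2 : C'.card < 2 ^ r := (Finset.card_filter_le _ _).trans_lt hC
  have h3 : C'.card * 2 ^ (W.card - r) < 2 ^ r * 2 ^ (W.card - r) :=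
    Nat.mul_lt_mul_of_pos_right h2 (by positivity)
  rw [← pow_add, Nat.add_sub_cancel' hrW] at h3
  omega

section CellColoring

variable {G X : Type*} [Group G] [MulAction G X]

open Classical in
/-- The colour of `u • x`, where the points of `D` are divided into cells, the centre of the cell
of `y` being `(e y)⁻¹ • y`, and `L v` is the pattern on the cell of `v • x`, if it is known. Outside
`D` the colours are given by `β`. -/
noncomputable def cellColor (D : X → Prop) (β : X → Option Bool) (e : X → G)
    (L : G → Option (Finset G)) (x : X) (u : G) : Option Bool :=
  if D (u • x) then (L ((e (u • x))⁻¹ * u)).map fun s => decide (e (u • x) ∈ s) else β (u • x)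

open Classical in
/-- The patterns around `x`, when that of the cell of `x` is `s`. -/
noncomputable def patternsWith (p : X → Option (Finset G)) (x : X) (s : Finset G) (v : G) :
    Option (Finset G) :=
  if v = 1 then some s else p (v • x)

open Classical in
/-- The edges between the windows at `t • x` and `k • t • x` that meet the cell of `x` and whose
ends both receive a colour as soon as the pattern on this cell is chosen. -/
noncomputable def activeEdges (W : Finset G) (D : X → Prop) (β : X → Option Bool) (e : X → G)
    (p : X → Option (Finset G)) (x : X) (t k : G) : Finset G :=
  W.filter fun i =>
    ((D ((i * t) • x) ∧ e ((i * t) • x) = i * t) ∨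
      (D ((i * k * t) • x) ∧ e ((i * k * t) • x) = i * k * t)) ∧
    cellColor D β e (patternsWith p x ∅) x (i * t) ≠ none ∧
    cellColor D β e (patternsWith p x ∅) x (i * k * t) ≠ none

/-- The pattern `s` on the cell of `x` separates the ends of an active edge of each constraint
that has sufficiently many of them. -/
def GoodPattern (W K : Finset G) (r : ℕ) (Y : X → Prop) (D : X → Prop) (β : X → Option Bool)
    (e : X → G) (p : X → Option (Finset G)) (x : X) (s : Finset G) : Prop :=
  ∀ t, ∀ k ∈ K, Y (t • x) → 3 * r ≤ (activeEdges W D β e p x t k).card →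
    ∃ i ∈ activeEdges W D β e p x t k,
      cellColor D β e (patternsWith p x s) x (i * t) ≠
        cellColor D β e (patternsWith p x s) x (i * k * t)

theorem cellColor_of_own {D : X → Prop} {β : X → Option Bool} {e : X → G}
    {p : X → Option (Finset G)} {x : X} {s : Finset G} {u : G}
    (hD : D (u • x)) (he : e (u • x) = u) :
    cellColor D β e (patternsWith p x s) x u = some (by classical exact decide (u ∈ s)) := by
  simp [cellColor, patternsWith, hD, he]

/-- Such a point is either outside `D` or has its centre away from `x`, so the pattern chosen at `x`
is never consulted. -/
theorem cellColor_of_not_own {D : X → Prop} {β : X → Option Bool} {e : X → G}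
    {p : X → Option (Finset G)} {x : X} {s s' : Finset G} {u : G}
    (h : ¬ (D (u • x) ∧ e (u • x) = u)) :
    cellColor D β e (patternsWith p x s) x u = cellColor D β e (patternsWith p x s') x u := by
  by_cases hD : D (u • x)
  · have : (e (u • x))⁻¹ * u ≠ 1 := fun h' => h ⟨hD, by rw [inv_mul_eq_one.1 h']⟩
    simp [cellColor, patternsWith, hD, this]
  · simp [cellColor, hD]

/-- The cell of `x` lies in `W • x`, so a constraint `(t, k)` with an active edge has `t = i⁻¹ * u`
or `t = k⁻¹ * i⁻¹ * u` with `i`, `u` in `W`. This leaves at most `2 * |K| * |W| ^ 2` constraints,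
few enough for `exists_pattern`. -/
theorem exists_goodPattern (W K : Finset G) (hK : ∀ k ∈ K, k ≠ 1) {r : ℕ} (hr0 : 0 < r)
    (hr : K.card * (2 * W.card ^ 2) < 2 ^ r) (Y D : X → Prop) (β : X → Option Bool) (e : X → G)
    (heW : ∀ x, D x → e x ∈ W) (p : X → Option (Finset G)) (x : X) :
    ∃ s ⊆ W, GoodPattern W K r Y D β e p x s := by
  classical
  let O : Set G := {u | D (u • x) ∧ e (u • x) = u}
  have hO : O ⊆ W := fun u hu => by
    have := heW _ hu.1
    rwa [hu.2] at this
  -- The default `false` is never read on active edges, whose ends are coloured.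
  let κ : G → Bool := fun u => (cellColor D β e (patternsWith p x ∅) x u).getD false
  let C : Finset (G × G) :=
    (K ×ˢ (W ×ˢ W)).image (fun q => (q.2.1⁻¹ * q.2.2, q.1)) ∪
      (K ×ˢ (W ×ˢ W)).image (fun q => (q.1⁻¹ * q.2.1⁻¹ * q.2.2, q.1))
  have hCcard : C.card < 2 ^ r := by
    refine lt_of_le_of_lt ?_ hr
    calc C.card ≤ (K ×ˢ (W ×ˢ W)).card + (K ×ˢ (W ×ˢ W)).card :=
          (Finset.card_union_le _ _).trans
            (add_le_add Finset.card_image_le Finset.card_image_le)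
      _ = _ := by simp only [Finset.card_product]; ring
  have hCK : ∀ q ∈ C, q.2 ∈ K := by
    intro q hq
    simp only [C, Finset.mem_union, Finset.mem_image, Finset.mem_product] at hq
    rcases hq with ⟨q', h, rfl⟩ | ⟨q', h, rfl⟩ <;> exact h.1
  obtain ⟨s, hsW, hs⟩ := exists_pattern W O hO κ C
    (fun q => activeEdges W D β e p x q.1 q.2) (fun q i => i * q.1) (fun q i => i * q.2 * q.1)
    (fun q i _ j _ h => mul_right_cancel h)
    (fun q i _ j _ h => mul_right_cancel (mul_right_cancel h))
    (fun q hq i _ h => hK _ (hCK q hq) (mul_eq_left.1 (mul_right_cancel h).symm))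
    (fun q _ i hi => (Finset.mem_filter.1 hi).2.1) r hCcard
  refine ⟨s, hsW, fun t k hk _ h3 => ?_⟩
  obtain ⟨i₀, hi₀⟩ := Finset.card_pos.1 (show 0 < (activeEdges W D β e p x t k).card by omega)
  obtain ⟨hi₀W, hown, -⟩ := Finset.mem_filter.1 hi₀
  have hmem : (t, k) ∈ C := by
    simp only [C, Finset.mem_union, Finset.mem_image, Finset.mem_product]
    rcases hown with h | h
    · exact Or.inl ⟨(k, i₀, i₀ * t), ⟨hk, hi₀W, hO h⟩, by simp⟩
    · exact Or.inr ⟨(k, i₀, i₀ * k * t), ⟨hk, hi₀W, hO h⟩, by simp [mul_assoc]⟩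
  obtain ⟨i, hi, hne⟩ := hs (t, k) hmem h3
  refine ⟨i, hi, ?_⟩
  obtain ⟨-, -, h1, h2⟩ := Finset.mem_filter.1 hi
  have key : ∀ u, cellColor D β e (patternsWith p x ∅) x u ≠ none →
      cellColor D β e (patternsWith p x s) x u = some (if u ∈ O then decide (u ∈ s) else κ u) := by
    intro u hu
    by_cases huO : u ∈ O
    · rw [cellColor_of_own huO.1 huO.2, if_pos huO]
    · rw [cellColor_of_not_own (s' := ∅) huO, if_neg huO]
      obtain ⟨v, hv⟩ := Option.ne_none_iff_exists'.1 hu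
      simp [κ, hv]
  rw [key _ h1, key _ h2]
  exact fun h => hne (by convert Option.some.inj h)

variable [Countable G] [MeasurableSpace X] [MeasurableConstSMul G X]

theorem measurableFibers_cellColor {D : X → Prop} {β : X → Option Bool} {e : X → G}
    (hD : Measurable D) (hβ : MeasurableFibers β) (he : MeasurableFibers e)
    {p : X → Option (Finset G)} (hp : MeasurableFibers p) (s : Finset G) (u : G) :
    MeasurableFibers fun x => cellColor D β e (patternsWith p x s) x u := by
  classical
  unfold cellColor
  refine measurableFibers_ite (hD.comp (measurable_const_smul u)) ?_
    (hβ.comp (measurable_const_smul u))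
  refine (he.comp (measurable_const_smul u)).bind
    (F := fun g x => (patternsWith p x s (g⁻¹ * u)).map fun s => decide (g ∈ s)) fun g => ?_
  have : MeasurableFibers fun x => patternsWith p x s (g⁻¹ * u) := by
    by_cases h : g⁻¹ * u = 1
    · simpa [patternsWith, h] using measurableFibers_const _
    · simpa [patternsWith, h] using hp.comp (measurable_const_smul (g⁻¹ * u))
  exact this.map _

theorem measurable_goodPattern (W K : Finset G) (r : ℕ) {Y D : X → Prop} {β : X → Option Bool}
    {e : X → G} (hY : Measurable Y) (hD : Measurable D) (hβ : MeasurableFibers β)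
    (he : MeasurableFibers e) {p : X → Option (Finset G)} (hp : MeasurableFibers p)
    (s : Finset G) : Measurable fun x => GoodPattern W K r Y D β e p x s := by
  classical
  have hcol := fun s u => measurableFibers_cellColor hD hβ he hp s u
  refine Measurable.forall fun t => Measurable.forall fun k => measurable_const.imp
    ((hY.comp (measurable_const_smul t)).imp ?_)
  have hown : ∀ u : G, Measurable fun x : X => D (u • x) ∧ e (u • x) = u := fun u =>
    (hD.comp (measurable_const_smul u)).and ((he.comp (measurable_const_smul u)) u)
  have hJ : MeasurableFibers fun x => activeEdges W D β e p x t k :=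
    measurableFibers_filter W fun i => ((hown _).or (hown _)).and
      (((hcol _ _ _).not).and ((hcol _ _ _).not))
  refine hJ.pred (q := fun x J => 3 * r ≤ J.card → ∃ i ∈ J,
      cellColor D β e (patternsWith p x s) x (i * t) ≠
        cellColor D β e (patternsWith p x s) x (i * k * t)) fun J => ?_
  refine measurable_const.imp (Measurable.exists fun i => measurable_const.and ?_)
  exact (hcol s (i * t)).pred
    (q := fun x c => c ≠ cellColor D β e (patternsWith p x s) x (i * k * t))
    fun c => (hcol s (i * k * t)).pred (q := fun _ c' => c ≠ c') fun _ => measurable_const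

/-- Points of `D`, divided into cells with centres in `Y`, may be coloured so that the windows at
`z` and `k • z` are coloured differently for all `z` in `Y` and `k` in `K`. -/
theorem exists_cell_coloring [StandardBorelSpace X]
    (hfree : ∀ (g : G) (x : X), g • x = x → g = 1)
    (W K : Finset G) (hK : ∀ k ∈ K, k ≠ 1) {r : ℕ} (hr0 : 0 < r)
    (hr : K.card * (2 * W.card ^ 2) < 2 ^ r) {Y D : X → Prop} {β : X → Option Bool} {e : X → G}
    (hY : Measurable Y) (hD : Measurable D) (hβ : MeasurableFibers β) (he : MeasurableFibers e)
    (heW : ∀ x, D x → e x ∈ W) (heY : ∀ y, Y y → ∀ i ∈ W, D (i • y) → e (i • y) = i)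
    (hone : ∀ z, Y z → ∀ k ∈ K, ∀ i ∈ W, ∀ j ∈ W, D ((i * k) • z) → D ((j * k) • z) →
      (e ((i * k) • z))⁻¹ * (i * k) = (e ((j * k) • z))⁻¹ * (j * k))
    (hmany : ∀ z, Y z → ∀ k ∈ K, ∃ I ⊆ W, 6 * r ≤ I.card ∧
      ∀ i ∈ I, D (i • z) ∧ (D ((i * k) • z) ∨ β ((i * k) • z) ≠ none)) :
    ∃ A : X → Option Bool, MeasurableFibers A ∧ (∀ x, ¬ D x → A x = β x) ∧
      ∀ z, Y z → ∀ k ∈ K, ∃ i : G, ∃ b, A (i • z) = some b ∧ A ((i * k) • z) = some (!b) := by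
  classical
  -- Distinct centres of cells joined by a constraint edge differ by an element of this set, so one
  -- of the two cells is decided strictly earlier.
  obtain ⟨c, hc, hcT⟩ := exists_nat_coloring hfree (W⁻¹ * (W * K))
  -- The choice depends only on the finite set of good patterns, which keeps it Borel; the default
  -- is not reached, as good patterns always exist.
  let pick : Finset (Finset G) → Finset G := fun S => if h : S.Nonempty then h.choose else ∅
  obtain ⟨f, hf, hfx⟩ := exists_greedy hc
    (fun x p => pick (W.powerset.filter (GoodPattern W K r Y D β e p x))) (fun p hp =>
      (measurableFibers_filter _ fun s =>
        measurable_goodPattern W K r hY hD hβ he hp s).map pick)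
  let p : X → X → Option (Finset G) := fun x y => if c y < c x then some (f y) else none
  have hgood : ∀ x, GoodPattern W K r Y D β e (p x) x (f x) := by
    intro x
    obtain ⟨s, hsW, hs⟩ := exists_goodPattern W K hK hr0 hr Y D β e heW (p x) x
    have hne : (W.powerset.filter (GoodPattern W K r Y D β e (p x) x)).Nonempty :=
      ⟨s, Finset.mem_filter.2 ⟨Finset.mem_powerset.2 hsW, hs⟩⟩
    have : f x = hne.choose := by
      rw [hfx x]
      exact dif_pos hne
    rw [this]
    exact (Finset.mem_filter.1 hne.choose_spec).2
  let A : X → Option Bool := fun x =>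
    if D x then some (decide (e x ∈ f ((e x)⁻¹ • x))) else β x
  have hAm : MeasurableFibers A := by
    refine measurableFibers_ite hD ?_ hβ
    refine he.bind (F := fun g x => some (decide (g ∈ f (g⁻¹ • x)))) fun g => ?_
    exact (hf.comp (measurable_const_smul g⁻¹)).map fun s => some (decide (g ∈ s))
  have hAcol : ∀ x u b, cellColor D β e (patternsWith (p x) x (f x)) x u = some b →
      A (u • x) = some b := by
    intro x u b h
    by_cases hDu : D (u • x)
    · simp only [cellColor, hDu, if_true, patternsWith, p] at h
      simp only [A, hDu, if_true]
      by_cases h1 : (e (u • x))⁻¹ * u = 1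
      · rw [if_pos h1] at h
        rw [← h, smul_smul, h1, one_smul]
        rfl
      · rw [if_neg h1] at h
        split_ifs at h with h2
        · rw [← h, smul_smul]
          rfl
        · simp at h
    · simpa [cellColor, hDu, A] using h
  have hsome : ∀ x u s, (D (u • x) → (e (u • x))⁻¹ * u = 1 ∨ c (((e (u • x))⁻¹ * u) • x) < c x) →
      (D (u • x) ∨ β (u • x) ≠ none) →
      cellColor D β e (patternsWith (p x) x s) x u ≠ none := by
    intro x u s h1 h2
    by_cases hDu : D (u • x)
    · rcases h1 hDu with h | h
      · simp [cellColor, hDu, patternsWith, h]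
      · by_cases h' : (e (u • x))⁻¹ * u = 1
        · simp [cellColor, hDu, patternsWith, h']
        · simp [cellColor, hDu, patternsWith, h', p, h]
    · simpa [cellColor, hDu] using h2
  have hind : ∀ x u s s', cellColor D β e (patternsWith (p x) x s) x u ≠ none →
      cellColor D β e (patternsWith (p x) x s') x u ≠ none := by
    intro x u s s' h
    by_cases ho : D (u • x) ∧ e (u • x) = u
    · rw [cellColor_of_own ho.1 ho.2]; simp
    · rwa [cellColor_of_not_own (s' := s) ho]
  have hfinish : ∀ x t, ∀ k ∈ K, Y (t • x) →
      3 * r ≤ (activeEdges W D β e (p x) x t k).card →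
      ∃ i : G, ∃ b, A (i • t • x) = some b ∧ A ((i * k) • t • x) = some (!b) := by
    intro x t k hk hYt h3
    obtain ⟨i, hi, hne⟩ := hgood x t k hk hYt h3
    obtain ⟨-, -, h1, h2⟩ := Finset.mem_filter.1 hi
    obtain ⟨b, hb⟩ := Option.ne_none_iff_exists'.1 (hind x _ _ (f x) h1)
    obtain ⟨b', hb'⟩ := Option.ne_none_iff_exists'.1 (hind x _ _ (f x) h2)
    have hbb : b' = !b := by
      rw [hb, hb'] at hne
      revert hne
      cases b <;> cases b' <;> simp
    refine ⟨i, b, ?_, ?_⟩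
    · rw [smul_smul]; exact hAcol _ _ _ hb
    · rw [smul_smul, ← hbb]; exact hAcol _ _ _ hb'
  refine ⟨A, hAm, fun x hx => by simp [A, hx], fun z hz k hk => ?_⟩
  obtain ⟨I, hIW, hI6, hI⟩ := hmany z hz k hk
  -- Late edges all end in one cell, by `hone`, which is decided after that of `z` and settles them.
  -- The far end of any other edge is coloured by `β`, or lies in the cell of `z` or an earlier one,
  -- so the cell of `z` settles it. One kind has at least `3 * r` edges.
  let late : G → Prop := fun i =>
    D ((i * k) • z) ∧ c z < c (((e ((i * k) • z))⁻¹ * (i * k)) • z)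
  by_cases hlate : 3 * r ≤ (I.filter late).card
  · obtain ⟨i₀, hi₀⟩ := Finset.card_pos.1 (show 0 < (I.filter late).card by omega)
    obtain ⟨hi₀I, hi₀D, hi₀c⟩ := Finset.mem_filter.1 hi₀
    set v := (e ((i₀ * k) • z))⁻¹ * (i₀ * k) with hv
    have := hfinish (v • z) v⁻¹ k hk (by rwa [inv_smul_smul]) (hlate.trans ?_)
    · simpa only [inv_smul_smul] using this
    refine Finset.card_le_card fun i hi => ?_
    obtain ⟨hiI, hiD, hic⟩ := Finset.mem_filter.1 hi
    have hev : (e ((i * k) • z))⁻¹ * (i * k) = v :=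
      hone z hz k hk i (hIW hiI) i₀ (hIW hi₀I) hiD hi₀D
    have e1 : (i * v⁻¹) • v • z = i • z := by rw [smul_smul]; simp
    have e2 : (i * k * v⁻¹) • v • z = (i * k) • z := by rw [smul_smul]; simp
    have e3 : e ((i * k) • z) = i * k * v⁻¹ := by rw [← hev]; group
    refine Finset.mem_filter.2 ⟨hIW hiI, Or.inr ⟨by rw [e2]; exact hiD, by rw [e2, e3]⟩, ?_, ?_⟩
    · refine hsome _ _ _ (fun h => ?_) (by rw [e1]; exact Or.inl (hI i hiI).1)
      right
      rw [e1, heY z hz i (hIW hiI) (hI i hiI).1, inv_mul_cancel_left, inv_smul_smul]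
      exact hi₀c
    · refine hsome _ _ _ (fun h => ?_) (by rw [e2]; exact Or.inl hiD)
      left
      rw [e2, e3, inv_mul_cancel]
  · have hearly : 3 * r ≤ (I.filter fun i => ¬ late i).card := by
      have := Finset.card_filter_add_card_filter_not (s := I) late
      omega
    have := hfinish z 1 k hk (by rwa [one_smul]) (hearly.trans ?_)
    · simpa only [one_smul] using this
    refine Finset.card_le_card fun i hi => ?_
    obtain ⟨hiI, hil⟩ := Finset.mem_filter.1 hi
    have hiz := heY z hz i (hIW hiI) (hI i hiI).1
    refine Finset.mem_filter.2 ⟨hIW hiI, ?_, ?_, ?_⟩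
    · rw [mul_one]
      exact Or.inl ⟨(hI i hiI).1, hiz⟩
    · rw [mul_one]
      exact hsome _ _ _ (fun _ => Or.inl (by rw [hiz, inv_mul_cancel])) (Or.inl (hI i hiI).1)
    · rw [mul_one]
      refine hsome _ _ _ (fun hDi => ?_) (hI i hiI).2
      by_cases h1 : (e ((i * k) • z))⁻¹ * (i * k) = 1
      · exact Or.inl h1
      · have hmem : (e ((i * k) • z))⁻¹ * (i * k) ∈ W⁻¹ * (W * K) :=
          Finset.mul_mem_mul (Finset.inv_mem_inv (heW _ hDi))
            (Finset.mul_mem_mul (hIW hiI) hk)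
        have hne := hcT z _ hmem h1
        have hnl : ¬ c z < c (((e ((i * k) • z))⁻¹ * (i * k)) • z) := fun h => hil ⟨hDi, h⟩
        exact Or.inr (by omega)

end CellColoring

/-- Here `m` will be `|F|` and the inner product bounds `|W|`. The exponent is `4 + 2`: there are at
most `|W| ^ 4` conjugates of `g` to treat, with `2 * |W| ^ 2` positions each. -/
theorem exists_pow_bound (m : ℕ) :
    ∃ r, 0 < r ∧ 2 * (m * (m * (6 * r + 2 * m))) ^ 6 < 2 ^ r := by
  have h := tendsto_pow_const_div_const_pow_of_one_lt 6 (one_lt_two (α := ℝ))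
  have hpos : (0 : ℝ) < 1 / (2 * (8 * (m : ℝ) ^ 2) ^ 6 + 1) := by positivity
  obtain ⟨r, hr, hrm⟩ :=
    ((h.eventually_lt_const hpos).and (Filter.eventually_ge_atTop (m + 1))).exists
  refine ⟨r, by omega, ?_⟩
  rw [div_lt_div_iff₀ (by positivity) (by positivity), one_mul] at hr
  have h1 : r ^ 6 * (2 * (8 * m ^ 2) ^ 6 + 1) < 2 ^ r := by exact_mod_cast hr
  calc 2 * (m * (m * (6 * r + 2 * m))) ^ 6 ≤ 2 * (m * (m * (6 * r + 2 * r))) ^ 6 := by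
        gcongr; omega
    _ = r ^ 6 * (2 * (8 * m ^ 2) ^ 6) := by ring
    _ ≤ r ^ 6 * (2 * (8 * m ^ 2) ^ 6 + 1) := by gcongr; omega
    _ < _ := h1

/-- If every translate `F • s • z` with `s ∈ S` meets the set `P`, then `P` contains many points of
the window `(F * S) • z`. -/
theorem card_le_mul_card_filter {G : Type*} [Group G] [DecidableEq G] (F S : Finset G)
    (P : G → Prop) [DecidablePred P] (h : ∀ s, ∃ f ∈ F, P (f * s)) :
    S.card ≤ F.card * ((F * S).filter P).card := by
  choose φ hφF hφ using h
  -- The map `s ↦ φ s * s` is at most `|F|`-to-one, since `s = f⁻¹ * u` for some `f` in `F`.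
  calc S.card ≤ F.card * (S.image fun s => φ s * s).card := by
        refine Finset.card_le_mul_card_image _ _ fun u _ => ?_
        refine (Finset.card_le_card (t := F.image fun f => f⁻¹ * u) fun s hs => ?_).trans
          Finset.card_image_le
        obtain ⟨-, hs⟩ := Finset.mem_filter.1 hs
        exact Finset.mem_image.2 ⟨φ s, hφF s, by rw [← hs]; simp⟩
    _ ≤ _ := by
        gcongr
        intro u hu
        obtain ⟨s, hs, rfl⟩ := Finset.mem_image.1 hu
        exact Finset.mem_filter.2 ⟨Finset.mul_mem_mul (hφF s) hs, hφ s⟩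

/-! ### Equivariant maps to the free part of the shift -/

/-- A partial colouring that leaves a syndetic set uncoloured extends to one with the same property
that separates `x` from `g • x` for all `x`. -/
theorem exists_separating_extension {G X : Type*} [Group G] [Countable G] [Infinite G]
    [MeasurableSpace X] [StandardBorelSpace X] [MulAction G X] [MeasurableConstSMul G X]
    (hfree : ∀ (g : G) (x : X), g • x = x → g = 1) {A : X → Option Bool}
    (hA : MeasurableFibers A) (hsynd : ∃ F : Finset G, ∀ x, ∃ h ∈ F, A (h • x) = none) {g : G}
    (hg : g ≠ 1) :
    ∃ A' : X → Option Bool, MeasurableFibers A' ∧ (∀ x b, A x = some b → A' x = some b) ∧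
      (∃ F : Finset G, ∀ x, ∃ h ∈ F, A' (h • x) = none) ∧
      ∀ x, ∃ (h : G) (b : Bool), A' (h • x) = some b ∧ A' ((h * g) • x) = some (!b) := by
  classical
  obtain ⟨F, hF1, hF⟩ : ∃ F : Finset G, 1 ∈ F ∧ ∀ x, ∃ h ∈ F, A (h • x) = none := by
    obtain ⟨F, hF⟩ := hsynd
    refine ⟨insert 1 F, Finset.mem_insert_self _ _, fun x => ?_⟩
    obtain ⟨h, hh, hx⟩ := hF x
    exact ⟨h, Finset.mem_insert_of_mem hh, hx⟩
  have hFpos : 0 < F.card := Finset.card_pos.2 ⟨1, hF1⟩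
  obtain ⟨r, hr0, hr⟩ := exists_pow_bound F.card
  -- This size gives each window at least `6 * r + 2 * |F|` uncoloured points; `2 * |F|` are given
  -- up to reserved points at the near and far ends of edges.
  obtain ⟨S, hS1, hScard⟩ := Infinite.exists_superset_card_eq ({1} : Finset G)
    (F.card * (6 * r + 2 * F.card)) (by
      rw [Finset.card_singleton]
      exact Nat.mul_pos hFpos (by omega))
  have h1S : (1 : G) ∈ S := hS1 (Finset.mem_singleton_self 1)
  set W : Finset G := F * S with hW
  have hFW : F ⊆ W := fun f hf => by simpa using Finset.mul_mem_mul hf h1S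
  have h1W : (1 : G) ∈ W := hFW hF1
  have hWcard : W.card ≤ F.card * (F.card * (6 * r + 2 * F.card)) :=
    hScard ▸ Finset.card_mul_le
  -- With this separation, the windows of centres in `Y` that meet one given translate of `W` all
  -- have the same centre (`hcentre`).
  set V : Finset G := (W⁻¹ * W) * (W⁻¹ * W) with hV
  have hWV : ∀ i ∈ W, ∀ j ∈ W, i⁻¹ * j ∈ W⁻¹ * W := fun i hi j hj =>
    Finset.mul_mem_mul (Finset.inv_mem_inv hi) hj
  have h1WW : (1 : G) ∈ W⁻¹ * W := by simpa using hWV 1 h1W 1 h1W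
  have h1V : (1 : G) ∈ V := by simpa using Finset.mul_mem_mul h1WW h1WW
  have hVinv : ∀ t ∈ V, t⁻¹ ∈ V := by
    have : V⁻¹ = V := by simp [hV, mul_inv_rev]
    intro t ht
    rw [← this]
    exact Finset.inv_mem_inv ht
  have hVcard : V.card ≤ W.card ^ 4 := by
    have h2 : (W⁻¹ * W).card ≤ W.card * W.card :=
      Finset.card_mul_le.trans (by rw [Finset.card_inv])
    calc V.card ≤ (W⁻¹ * W).card * (W⁻¹ * W).card := Finset.card_mul_le
      _ ≤ (W.card * W.card) * (W.card * W.card) := Nat.mul_le_mul h2 h2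
      _ = _ := by ring
  obtain ⟨Y, hY, hYsep, hYmax⟩ := exists_maximal_separated hfree V h1V hVinv
  have hsep : ∀ y, Y y → ∀ t ∈ V, Y (t • y) → t = 1 := fun y hy t ht hty => by
    by_contra h
    exact hYsep y hy t ht h hty
  have hcentre : ∀ (z : X) (u : G), ∀ i ∈ W, ∀ j ∈ W, ∀ i' ∈ W, ∀ j' ∈ W,
      Y ((i'⁻¹ * (i * u)) • z) → Y ((j'⁻¹ * (j * u)) • z) →
      i'⁻¹ * (i * u) = j'⁻¹ * (j * u) := by
    intro z u i hi j hj i' hi' j' hj' h1 h2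
    have ht : (i'⁻¹ * i) * (j⁻¹ * j') ∈ V :=
      Finset.mul_mem_mul (hWV _ hi' _ hi) (hWV _ hj _ hj')
    have := hsep _ h2 _ ht (by
      rw [smul_smul]
      convert h1 using 2
      group)
    calc i'⁻¹ * (i * u) = ((i'⁻¹ * i) * (j⁻¹ * j')) * (j'⁻¹ * (j * u)) := by group
      _ = _ := by rw [this, one_mul]
  have hcentre1 : ∀ z, Y z → ∀ i ∈ W, ∀ i' ∈ W, Y (i'⁻¹ • i • z) → i' = i := by
    intro z hz i hi i' hi' h
    have := hcentre z 1 i hi 1 h1W i' hi' 1 h1W (by simpa [smul_smul] using h) (by simpa using hz)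
    simpa [inv_mul_eq_one] using this
  -- The translates of centres by `F` are reserved: each `F • y` contains an uncoloured point, which
  -- stays uncoloured and preserves syndeticity.
  let R : X → Prop := fun x => ∃ f ∈ F, Y (f⁻¹ • x)
  let D : X → Prop := fun x => A x = none ∧ ¬ R x ∧ ∃ i ∈ W, Y (i⁻¹ • x)
  let pick : Finset G → G := fun s => if h : s.Nonempty then h.choose else 1
  let e : X → G := fun x => pick (W.filter fun i => Y (i⁻¹ • x))
  let β : X → Option Bool := fun x =>
    if A x = none then (if R x then none else some false) else A x
  have hYs : ∀ u : G, Measurable fun x => Y (u • x) := fun u => hY.comp (measurable_const_smul u)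
  have hR : Measurable R := Measurable.exists fun f => measurable_const.and (hYs _)
  have hD : Measurable D := (hA none).and (hR.not.and
    (Measurable.exists fun i => measurable_const.and (hYs _)))
  have he : MeasurableFibers e := (measurableFibers_filter W fun i => hYs i⁻¹).map pick
  have hβ : MeasurableFibers β := measurableFibers_ite (hA none)
    (measurableFibers_ite hR (measurableFibers_const _) (measurableFibers_const _)) hA
  have heD : ∀ x, D x → e x ∈ W ∧ Y ((e x)⁻¹ • x) := by
    intro x hx
    have hne : (W.filter fun i => Y (i⁻¹ • x)).Nonempty := by
      obtain ⟨i, hi, hiY⟩ := hx.2.2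
      exact ⟨i, Finset.mem_filter.2 ⟨hi, hiY⟩⟩
    have h : e x = hne.choose := dif_pos hne
    rw [h]
    exact Finset.mem_filter.1 hne.choose_spec
  have hβR : ∀ x, ¬ R x → β x ≠ none := by
    intro x hx
    by_cases h : A x = none <;> simp [β, hx, h]
  -- Moving `x` to a centre `v • x` with `v` in `V` turns `g` into `v * g * v⁻¹`.
  let K : Finset G := V.image fun h => h * g * h⁻¹
  have hK : ∀ k ∈ K, k ≠ 1 := by
    intro k hk h1
    obtain ⟨h, -, rfl⟩ := Finset.mem_image.1 hk
    exact hg (conj_eq_one_iff.1 h1)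
  have hKcard : K.card * (2 * W.card ^ 2) < 2 ^ r := by
    calc K.card * (2 * W.card ^ 2) ≤ W.card ^ 4 * (2 * W.card ^ 2) := by
          gcongr
          exact Finset.card_image_le.trans hVcard
      _ = 2 * W.card ^ 6 := by ring
      _ ≤ 2 * (F.card * (F.card * (6 * r + 2 * F.card))) ^ 6 := by gcongr
      _ < _ := hr
  obtain ⟨A', hA', hA'β, hA'K⟩ := exists_cell_coloring hfree W K hK hr0 hKcard hY hD hβ he
    (fun x hx => (heD x hx).1)
    (fun y hy i hi hDi => hcentre1 y hy i hi _ (heD _ hDi).1 (heD _ hDi).2)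
    (fun z _ k _ i hi j hj hDi hDj => hcentre z k i hi j hj _ (heD _ hDi).1 _ (heD _ hDj).1
      (by simpa only [smul_smul] using (heD _ hDi).2)
      (by simpa only [smul_smul] using (heD _ hDj).2))
    (fun z hz k _ => by
      let U := W.filter fun i => A (i • z) = none
      let R₁ := W.filter fun i => R (i • z)
      let R₂ := W.filter fun i => R ((i * k) • z)
      have hU : 6 * r + 2 * F.card ≤ U.card := by
        have := card_le_mul_card_filter F S (fun i => A (i • z) = none) (fun s => by
          obtain ⟨f, hf, hfs⟩ := hF (s • z)
          exact ⟨f, hf, by rwa [mul_smul]⟩)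
        rw [hScard] at this
        exact Nat.le_of_mul_le_mul_left this hFpos
      have hR₁ : R₁.card ≤ F.card := by
        refine Finset.card_le_card fun i hi => ?_
        obtain ⟨hiW, f, hf, hfY⟩ := Finset.mem_filter.1 hi
        exact hcentre1 z hz i hiW f (hFW hf) hfY ▸ hf
      -- All reserved far ends belong to a single centre, that of `i₀`.
      have hR₂ : R₂.card ≤ F.card := by
        rcases R₂.eq_empty_or_nonempty with h | ⟨i₀, hi₀⟩
        · simp [h]
        · obtain ⟨hi₀W, f₀, hf₀, hf₀Y⟩ := Finset.mem_filter.1 hi₀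
          refine (Finset.card_le_card (t := F.image fun f => f * (f₀⁻¹ * (i₀ * k)) * k⁻¹)
            fun i hi => ?_).trans Finset.card_image_le
          obtain ⟨hiW, f, hf, hfY⟩ := Finset.mem_filter.1 hi
          refine Finset.mem_image.2 ⟨f, hf, ?_⟩
          rw [← hcentre z k i hiW i₀ hi₀W f (hFW hf) f₀ (hFW hf₀)
            (by simpa only [smul_smul] using hfY) (by simpa only [smul_smul] using hf₀Y)]
          group
      refine ⟨U \ (R₁ ∪ R₂), Finset.sdiff_subset.trans (Finset.filter_subset _ _), ?_, ?_⟩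
      · have h1 := Finset.le_card_sdiff (R₁ ∪ R₂) U
        have h2 := Finset.card_union_le R₁ R₂
        omega
      · intro i hi
        obtain ⟨hiU, hiR⟩ := Finset.mem_sdiff.1 hi
        obtain ⟨hiW, hiA⟩ := Finset.mem_filter.1 hiU
        rw [Finset.mem_union, not_or] at hiR
        refine ⟨⟨hiA, fun h => hiR.1 (Finset.mem_filter.2 ⟨hiW, h⟩), i, hiW, ?_⟩,
          Or.inr (hβR _ fun h => hiR.2 (Finset.mem_filter.2 ⟨hiW, h⟩))⟩
        rwa [inv_smul_smul])
  refine ⟨A', hA', fun x b hx => ?_, ⟨F * V, fun x => ?_⟩, fun x => ?_⟩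
  · rw [hA'β x fun h => by simp [h.1] at hx]
    simp [β, hx]
  · obtain ⟨v, hv, hvY⟩ := hYmax x
    obtain ⟨f, hf, hfA⟩ := hF (v • x)
    have hRx : R (f • v • x) := ⟨f, hf, by rwa [inv_smul_smul]⟩
    refine ⟨f * v, Finset.mul_mem_mul hf hv, ?_⟩
    rw [mul_smul, hA'β _ fun h => h.2.1 hRx]
    simp [β, hfA, hRx]
  · obtain ⟨v, hv, hvY⟩ := hYmax x
    obtain ⟨i, b, h1, h2⟩ := hA'K _ hvY (v * g * v⁻¹) (Finset.mem_image_of_mem _ hv)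
    refine ⟨i * v, b, by rwa [mul_smul], ?_⟩
    rw [smul_smul] at h2
    convert h2 using 3
    group

/-- Every free Borel action has a Borel set that separates the points of every orbit. -/
theorem exists_separating_set {G X : Type*} [Group G] [Countable G] [Infinite G]
    [MeasurableSpace X] [StandardBorelSpace X] [MulAction G X] [MeasurableConstSMul G X]
    (hfree : ∀ (g : G) (x : X), g • x = x → g = 1) :
    ∃ A : X → Prop, Measurable A ∧
      ∀ (g : G), g ≠ 1 → ∀ x, ∃ h : G, ¬ (A (h • x) ↔ A ((h * g) • x)) := by
  classical
  obtain ⟨enum, henum⟩ := exists_surjective_nat G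
  let P := {A : X → Option Bool //
    MeasurableFibers A ∧ ∃ F : Finset G, ∀ x, ∃ h ∈ F, A (h • x) = none}
  have hstep : ∀ (n : ℕ) (A : P), ∃ A' : P, (∀ x b, A.1 x = some b → A'.1 x = some b) ∧
      (enum n ≠ 1 → ∀ x, ∃ (h : G) (b : Bool),
        A'.1 (h • x) = some b ∧ A'.1 ((h * enum n) • x) = some (!b)) := by
    intro n A
    by_cases hg : enum n = 1
    · exact ⟨A, fun _ _ h => h, fun h => (h hg).elim⟩
    · obtain ⟨A', h1, h2, h3, h4⟩ := exists_separating_extension hfree A.2.1 A.2.2 hg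
      exact ⟨⟨A', h1, h3⟩, h2, fun _ => h4⟩
  choose next hnext hsep using hstep
  let s : ℕ → P := fun n => Nat.rec
    ⟨fun _ => none, measurableFibers_const _, {1}, fun x => ⟨1, by simp, rfl⟩⟩ next n
  have hs : ∀ n, s (n + 1) = next n (s n) := fun _ => rfl
  have hmono : ∀ m n, m ≤ n → ∀ x b, (s m).1 x = some b → (s n).1 x = some b := by
    intro m n hmn x b h
    induction n, hmn using Nat.le_induction with
    | base => exact h
    | succ n _ ih => rw [hs]; exact hnext _ _ _ _ ih
  -- Points never coloured fall outside `A`; this is harmless, as each separation is witnessed by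
  -- points coloured at a finite stage.
  let A : X → Prop := fun x => ∃ n, (s n).1 x = some true
  have hAs : ∀ n x b, (s n).1 x = some b → (A x ↔ b = true) := by
    intro n x b h
    refine ⟨fun ⟨m, hm⟩ => ?_, fun hb => ⟨n, hb ▸ h⟩⟩
    have h1 := hmono n (max m n) (le_max_right _ _) x b h
    have h2 := hmono m (max m n) (le_max_left _ _) x true hm
    rw [h1] at h2
    exact Option.some.inj h2
  refine ⟨A, Measurable.exists fun n => (s n).2.1 _, fun g hg x => ?_⟩
  obtain ⟨n, rfl⟩ := henum g
  obtain ⟨h, b, h1, h2⟩ := hsep n (s n) hg x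
  rw [← hs] at h1 h2
  refine ⟨h, ?_⟩
  rw [hAs (n + 1) _ b h1, hAs (n + 1) _ (!b) h2]
  cases b <;> simp

/-- Every free Borel action maps equivariantly to the free part of the `2`-shift. -/
theorem exists_equivariant_map_freePart {G X : Type*} [Group G] [Countable G] [Infinite G]
    [MeasurableSpace X] [StandardBorelSpace X] [MulAction G X] [MeasurableConstSMul G X]
    (hfree : ∀ (g : G) (x : X), g • x = x → g = 1) :
    ∃ φ : X → freePart G (Fin 2), Measurable φ ∧ ∀ (g : G) (x : X), φ (g • x) = g • φ x := by
  classical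
  obtain ⟨A, hA, hsep⟩ := exists_separating_set hfree
  let ψ : X → Shift G (Fin 2) := fun x h => if A (h⁻¹ • x) then 1 else 0
  have hψ : ∀ (g : G) (x : X), ψ (g • x) = g • ψ x := by
    intro g x
    funext h
    change (if A (h⁻¹ • g • x) then (1 : Fin 2) else 0) =
      if A ((g⁻¹ * h)⁻¹ • x) then (1 : Fin 2) else 0
    rw [smul_smul, mul_inv_rev, inv_inv]
  have hmem : ∀ x, ψ x ∈ freePart G (Fin 2) := by
    intro x g hg hgx
    obtain ⟨h, hh⟩ := hsep g hg x
    rw [← hψ] at hgx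
    have := congrFun hgx h⁻¹
    change (if A (h⁻¹⁻¹ • g • x) then (1 : Fin 2) else 0) =
      if A (h⁻¹⁻¹ • x) then (1 : Fin 2) else 0 at this
    rw [inv_inv, smul_smul] at this
    apply hh
    by_cases h1 : A (h • x) <;> by_cases h2 : A ((h * g) • x) <;> simp [h1, h2] at this ⊢
  have hψm : Measurable ψ := by
    refine measurable_pi_lambda (X := fun _ : G => Fin 2) _ fun h => ?_
    exact Measurable.ite (measurableSet_setOfPred.2 (hA.comp (measurable_const_smul h⁻¹)))
      measurable_const measurable_const
  exact ⟨fun x => ⟨ψ x, hmem x⟩, hψm.subtype_mk, fun g x => Subtype.ext (hψ g x)⟩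

/-- Structurability pulls back along equivariant Borel maps from free actions. -/
theorem IsBorelStructurable.comap {G : Type*} [Group G] [Countable G]
    {L : FirstOrder.Language.{v, w}} [L.IsRelational] {K : Set (Bundled.{u} L.Structure)}
    (hK : ∀ M ∈ K, ∀ N : Bundled.{u} L.Structure, Nonempty (L.Equiv M N) → N ∈ K)
    {X Z : Type u} [MeasurableSpace X] [StandardBorelSpace X] [MulAction G X]
    [MeasurableConstSMul G X] [MeasurableSpace Z] [MulAction G Z]
    (hfree : ∀ (g : G) (z : Z), g • z = z → g = 1) {φ : X → Z} (hφ : Measurable φ)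
    (hequi : ∀ (g : G) (x : X), φ (g • x) = g • φ x)
    (h : IsBorelStructurable K (MulAction.orbitRel G Z)) :
    IsBorelStructurable K (MulAction.orbitRel G X) := by
  obtain ⟨Q, hQ⟩ := h
  let E : Setoid X := MulAction.orbitRel G X
  -- Restricting to `E` is needed because `φ` may identify different orbits; `E` is Borel as a
  -- countable union of graphs.
  refine ⟨fun n R => {a | (∀ i j, E.r (a i) (a j)) ∧ (fun i => φ (a i)) ∈ Q n R}, ?_, ?_, ?_⟩
  · intro n R
    have h1 : MeasurableSet {a : Fin n → X | ∀ i j, E.r (a i) (a j)} := by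
      have : {a : Fin n → X | ∀ i j, E.r (a i) (a j)} =
          ⋂ i, ⋂ j, ⋃ g : G, {a : Fin n → X | g • a j = a i} := by
        ext a
        simp only [Set.mem_iInter, Set.mem_iUnion]
        rfl
      rw [this]
      exact MeasurableSet.iInter fun i => MeasurableSet.iInter fun j => MeasurableSet.iUnion
        fun g => measurableSet_eq_fun ((measurable_const_smul g).comp (measurable_pi_apply j))
          (measurable_pi_apply i)
    have h2 : Measurable fun (a : Fin n → X) i => φ (a i) :=
      measurable_pi_lambda _ fun i => hφ.comp (measurable_pi_apply i)
    exact h1.inter (h2 (hQ.measurableSet n R))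
  · intro n R a ha
    exact ha.1
  · intro x
    have hcls : ∀ y : X, E.r y x → (MulAction.orbitRel G Z).r (φ y) (φ x) := by
      rintro y ⟨g, rfl⟩
      exact ⟨g, (hequi g x).symm⟩
    let F : {y : X | E.r y x} → {z : Z | (MulAction.orbitRel G Z).r z (φ x)} :=
      fun y => ⟨φ y, hcls y y.2⟩
    have hF : Function.Bijective F := by
      constructor
      · rintro ⟨y, g, rfl⟩ ⟨y', g', rfl⟩ hyy
        have h1 : φ (g • x) = φ (g' • x) := congrArg Subtype.val hyy
        rw [hequi, hequi, ← inv_smul_eq_iff, smul_smul] at h1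
        have := hfree _ _ h1
        have hgg : g = g' := (inv_mul_eq_one.1 this).symm
        subst hgg
        rfl
      · rintro ⟨z, g, rfl⟩
        exact ⟨⟨g • x, g, rfl⟩, Subtype.ext (hequi g x)⟩
    let _ : L.Structure {y : X | E.r y x} := restrictStructure
      (fun n R => {a | (∀ i j, E.r (a i) (a j)) ∧ (fun i => φ (a i)) ∈ Q n R}) _
    let _ : L.Structure {z : Z | (MulAction.orbitRel G Z).r z (φ x)} := restrictStructure Q _
    let I : L.Equiv {y : X | E.r y x} {z : Z | (MulAction.orbitRel G Z).r z (φ x)} :=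
      { toEquiv := Equiv.ofBijective F hF
        map_fun' := fun f => isEmptyElim f
        map_rel' := fun R a =>
          ⟨fun ha => ⟨fun i j => E.trans (a i).2 (E.symm (a j).2), ha⟩, fun ha => ha.2⟩ }
    exact hK _ (hQ.mem_class (φ x)) _ ⟨I.symm⟩

end BorelStructurability

theorem corollary2p3
    {G : Type u} [Group G] [Countable G] [Infinite G]
    {L : FirstOrder.Language.{v, w}} [L.IsRelational] [Countable (Σ n, L.Relations n)]
    (K : Set (CategoryTheory.Bundled.{u} L.Structure))
    (hK_countable : ∀ M ∈ K, Countable M)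
    (hK_iso : ∀ M ∈ K, ∀ N : CategoryTheory.Bundled.{u} L.Structure,
      Nonempty (L.Equiv M N) → N ∈ K)
    (hF : BorelStructurability.IsBorelStructurable K
      (BorelStructurability.freeShiftRel G (Fin 2))) :
    ∀ (X : Type u) [MeasurableSpace X] [StandardBorelSpace X] [MulAction G X]
      [MeasurableConstSMul G X],
      (∀ (g : G) (x : X), g • x = x → g = 1) →
        BorelStructurability.IsBorelStructurable K (MulAction.orbitRel G X) := by
  intro X _ _ _ _ hfree
  obtain ⟨φ, hφ, hequi⟩ := BorelStructurability.exists_equivariant_map_freePart hfree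
  refine BorelStructurability.IsBorelStructurable.comap hK_iso (fun g z hz => ?_) hφ hequi hF
  by_contra hg
  exact z.2 g hg (congrArg Subtype.val hz)
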